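/- There is a universal constant $C>0$ such that the following holds. Let $L,B>0$, let $\epsilon\in(0,\tfrac{LB}{2})$, let the dimension $d$ satisfy $d\ge \frac{2L^8B^8}{\epsilon^8}\log\frac{L^4B^4}{\epsilon^4}$, and let $K=\{x\in\mathbb{R}^d:\|x\|\le B\}$ (Euclidean norm). A first-order oracle for a convex function $f:K\to\mathbb{R}$ answers a query $x\in K$ with the value $f(x)$ and with one subgradient $g$ of $f$ at $x$ of its choice, i.e. a vector $g$ with $f(y)\ge f(x)+\langle g,y-x\rangle$ for all $y\in K$. A randomized first-order algorithm chooses its queries $x^{(1)},x^{(2)},\dots\in K$ one after the other, each as a (measurable) function of its random seed and of the oracle's responses to its previous queries. Then for every randomized first-order algorithm there exist a convex function $f:K\to\mathbb{R}$ that is $L$-Lipschitz with respect to the Euclidean norm, and a (measurable) first-order oracle for $f$ whose subgradients all have norm at most $L$, such that, when the algorithm is run with this oracle, the number $T\in\{1,2,\dots\}\cup\{\infty\}$ of queries up to and including the first query $x^{(T)}$ that satisfies $f(x^{(T)})\le\min_{x\in K}f(x)+\epsilon$ obeys $$\mathbb{E}[T]\;\ge\; C\,\frac{L^2B^2}{\epsilon^2}.$$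 -/

import Mathlib

open scoped ENNReal

/-- `d`-dimensional Euclidean space. -/
abbrev Euc (d : ℕ) : Type := EuclideanSpace ℝ (Fin d)

/-- The feasible set: the closed Euclidean ball of radius `B` around the origin. -/
abbrev feasible (d : ℕ) (B : ℝ) : Set (Euc d) := Metric.closedBall 0 B

/-- What an oracle returns at a query: a function value and a vector. -/
abbrev Response (d : ℕ) : Type := ℝ × Euc d

/-- `g` is a subgradient at `x` of the function `f` with domain `K`. -/
def IsSubgradientOn {d : ℕ} (K : Set (Euc d)) (f : Euc d → ℝ) (x g : Euc d) : Prop :=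
  ∀ y ∈ K, f x + inner ℝ g (y - x) ≤ f y

/-- `O` is a valid first-order oracle for `f` on `K`: at every point of `K` it answers with the
value of `f` and with some subgradient of `f` (which one is up to the oracle). -/
def IsFirstOrderOracle {d : ℕ} (K : Set (Euc d)) (f : Euc d → ℝ)
    (O : Euc d → Response d) : Prop :=
  ∀ x ∈ K, (O x).1 = f x ∧ IsSubgradientOn K f x (O x).2

/-- `x` is a feasible point whose value is within `ε` of the minimum of `f` on `K`. -/
def IsSuboptimal {d : ℕ} (K : Set (Euc d)) (f : Euc d → ℝ) (ε : ℝ) (x : Euc d) : Prop :=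
  x ∈ K ∧ ∀ y ∈ K, f x ≤ f y + ε

/-- A randomized algorithm with source of randomness `Ω`: given the random outcome `ω` and the
responses to the first `t` queries, it selects the next query point, in the ball of radius `B`.
(Earlier queries are functions of `ω` and of the earlier responses, so they need not be passed
on; `ω` may hold independent fresh randomness for every step.) -/
structure RandomizedAlgorithm (d : ℕ) (B : ℝ) (Ω : Type*) [MeasurableSpace Ω] where
  query : (t : ℕ) → Ω → (Fin t → Response d) → Euc d
  measurable_query : ∀ t : ℕ,
    Measurable (fun p : Ω × (Fin t → Response d) => query t p.1 p.2)
  query_mem : ∀ t ω h, query t ω h ∈ feasible d B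

namespace RandomizedAlgorithm

variable {d : ℕ} {B : ℝ} {Ω : Type*} [MeasurableSpace Ω]

/-- The first `t` responses received when the algorithm runs against the oracle `O`. -/
def history (A : RandomizedAlgorithm d B Ω) (O : Euc d → Response d) (ω : Ω) :
    (t : ℕ) → Fin t → Response d
  | 0 => fun i => i.elim0
  | t + 1 => Fin.snoc (α := fun _ => Response d) (A.history O ω t)
      (O (A.query t ω (A.history O ω t)))

/-- The query points, numbered from `0`, of the run against the oracle `O`. -/
def iterate (A : RandomizedAlgorithm d B Ω) (O : Euc d → Response d) (ω : Ω) (t : ℕ) : Euc d :=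
  A.query t ω (A.history O ω t)

/-- The number of queries made up to and including the first one at an `ε`-suboptimal point
(`∞` if there is none). -/
noncomputable def queryCount (A : RandomizedAlgorithm d B Ω) (O : Euc d → Response d)
    (f : Euc d → ℝ) (ε : ℝ) (ω : Ω) : ℝ≥0∞ :=
  ⨅ (t : ℕ) (_ : IsSuboptimal (feasible d B) f ε (A.iterate O ω t)), ((t + 1 : ℕ) : ℝ≥0∞)

end RandomizedAlgorithm

/-!
The hard functions are `f_s x = L * max_{i < n} s i * x i`, for sign vectors `s : Fin n → {±1}` and
a number `n` of coordinates of the order of `L² B² / ε²` but smaller, so that the minimum of `f_s` on the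
ball, `-L B / √n`, is smaller than `-ε`. A suboptimal point therefore has `f_s x < 0`, that is, all
its signed coordinates are negative (`IsSuboptimal.signedCoord_neg`): it guesses every sign of `s`.

For uniformly random `s` a query reveals only about two new signs on average. Inspect the unknown
signs in the order of decreasing `|x i|`. As soon as one of them makes its signed coordinate
nonnegative, that coordinate dominates all those not yet inspected, so value and subgradient depend
only on the signs inspected so far (`hardOracle_congr`), and each inspected sign has this effect with
probability `1 / 2`. An induction on the number `r` of remaining queries and on the number `m` of
unknown signs turns this into the bound `3 ^ r * (3 / 4) ^ m` for the fraction of sign vectors for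
which one of the queries succeeds (`card_hitSet_le`). With `m = n = 4 * (r + 1)` it is at most `1 / 2`.

This holds for every outcome of the algorithm's randomness. Averaging over outcomes and sign vectors
yields one sign vector for which the first `r` queries all fail with probability at least `1 / 2`
(`exists_half_le_measure_missEvent`), hence an expected query count of at least `(r + 1) / 2`, which
is of order `L² B² / ε²`. The only demand on the dimension is `n ≤ d`.
-/

/-! ### The hard functions and their oracles -/

/-- The sign `±1` encoded by a Boolean. -/
def boolSign (b : Bool) : ℝ := if b then 1 else -1

/-- The coordinate of `x` with index `e i`, multiplied by the `i`-th sign of `s`. -/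
def signedCoord {n d : ℕ} (e : Fin n ↪ Fin d) (s : Fin n → Bool) (x : Euc d) (i : Fin n) : ℝ :=
  boolSign (s i) * x (e i)

/-- `i` is the smallest index at which the signed coordinate of `x` is maximal. -/
def IsLeastArgmax {n d : ℕ} (e : Fin n ↪ Fin d) (s : Fin n → Bool) (x : Euc d) (i : Fin n) :
    Prop :=
  ∀ j, signedCoord e s x j < signedCoord e s x i ∨
    (signedCoord e s x j = signedCoord e s x i ∧ i ≤ j)

section HardFunction

variable {n d : ℕ} (e : Fin n ↪ Fin d) (s : Fin n → Bool)

theorem boolSign_mul_self (b : Bool) : boolSign b * boolSign b = 1 := by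
  cases b <;> simp [boolSign]

theorem abs_boolSign (b : Bool) : |boolSign b| = 1 := by
  cases b <;> simp [boolSign]

theorem abs_signedCoord (x : Euc d) (i : Fin n) : |signedCoord e s x i| = |x (e i)| := by
  rw [signedCoord, abs_mul, abs_boolSign, one_mul]

theorem IsLeastArgmax.signedCoord_le {e : Fin n ↪ Fin d} {s : Fin n → Bool} {x : Euc d}
    {i : Fin n} (h : IsLeastArgmax e s x i) (j : Fin n) :
    signedCoord e s x j ≤ signedCoord e s x i := by
  rcases h j with h | h
  · exact h.le
  · exact h.1.le

theorem IsLeastArgmax.unique {e : Fin n ↪ Fin d} {s : Fin n → Bool} {x : Euc d} {i j : Fin n}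
    (hi : IsLeastArgmax e s x i) (hj : IsLeastArgmax e s x j) : i = j := by
  rcases hi j with h | h <;> rcases hj i with h' | h'
  · linarith
  · linarith
  · linarith
  · exact le_antisymm h.2 h'.2

theorem measurable_signedCoord (i : Fin n) : Measurable fun x : Euc d => signedCoord e s x i := by
  unfold signedCoord
  fun_prop

variable [NeZero n]

theorem exists_isLeastArgmax (x : Euc d) : ∃ i, IsLeastArgmax e s x i := by
  obtain ⟨i, hi⟩ := Finite.exists_min
    (fun i : Fin n => toLex (-signedCoord e s x i, i))
  refine ⟨i, fun j => ?_⟩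
  rcases (Prod.Lex.toLex_le_toLex).1 (hi j) with h | h
  · exact Or.inl (neg_lt_neg_iff.1 h)
  · exact Or.inr ⟨(neg_injective h.1).symm, h.2⟩

/-- The smallest index at which the signed coordinate of `x` is maximal. -/
noncomputable def leastArgmax (x : Euc d) : Fin n := (exists_isLeastArgmax e s x).choose

theorem isLeastArgmax_leastArgmax (x : Euc d) : IsLeastArgmax e s x (leastArgmax e s x) :=
  (exists_isLeastArgmax e s x).choose_spec

/-- The hard function `x ↦ L * max i, s i * x (e i)`. -/
noncomputable def hardFun (L : ℝ) (x : Euc d) : ℝ :=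
  L * signedCoord e s x (leastArgmax e s x)

/-- The first-order oracle of the hard function which answers with the subgradient given by the
first maximal signed coordinate. -/
noncomputable def hardOracle (L : ℝ) (x : Euc d) : Response d :=
  (hardFun e s L x,
    EuclideanSpace.single (e (leastArgmax e s x)) (L * boolSign (s (leastArgmax e s x))))

theorem mul_signedCoord_le_hardFun {L : ℝ} (hL : 0 < L) (x : Euc d) (i : Fin n) :
    L * signedCoord e s x i ≤ hardFun e s L x :=
  mul_le_mul_of_nonneg_left ((isLeastArgmax_leastArgmax e s x).signedCoord_le i) hL.le

theorem convexOn_hardFun {L : ℝ} (hL : 0 < L) {K : Set (Euc d)} (hK : Convex ℝ K) :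
    ConvexOn ℝ K (hardFun e s L) := by
  refine ⟨hK, fun x _ y _ a b ha hb _ => ?_⟩
  have hx := mul_signedCoord_le_hardFun e s hL x (leastArgmax e s (a • x + b • y))
  have hy := mul_signedCoord_le_hardFun e s hL y (leastArgmax e s (a • x + b • y))
  calc hardFun e s L (a • x + b • y)
      = a * (L * signedCoord e s x (leastArgmax e s (a • x + b • y)))
        + b * (L * signedCoord e s y (leastArgmax e s (a • x + b • y))) := by
        simp only [hardFun, signedCoord, PiLp.add_apply, PiLp.smul_apply, smul_eq_mul]
        ring
    _ ≤ a • hardFun e s L x + b • hardFun e s L y :=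
        add_le_add (mul_le_mul_of_nonneg_left hx ha) (mul_le_mul_of_nonneg_left hy hb)

theorem lipschitzOnWith_hardFun {L : ℝ} (hL : 0 < L) (K : Set (Euc d)) :
    LipschitzOnWith L.toNNReal (hardFun e s L) K := by
  refine LipschitzOnWith.of_le_add_mul _ fun x _ y _ => ?_
  rw [Real.coe_toNNReal _ hL.le]
  have hy := mul_signedCoord_le_hardFun e s hL y (leastArgmax e s x)
  have hxy : signedCoord e s x (leastArgmax e s x) - signedCoord e s y (leastArgmax e s x)
      ≤ dist x y := by
    calc _ = signedCoord e s (x - y) (leastArgmax e s x) := by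
            simp only [signedCoord, PiLp.sub_apply]; ring
      _ ≤ |(x - y) (e (leastArgmax e s x))| := by
            rw [← abs_signedCoord e s]; exact le_abs_self _
      _ ≤ dist x y := by
            rw [dist_eq_norm, ← Real.norm_eq_abs]; exact PiLp.norm_apply_le _ _
  have := mul_le_mul_of_nonneg_left hxy hL.le
  unfold hardFun at *
  linarith

theorem isFirstOrderOracle_hardOracle {L : ℝ} (hL : 0 < L) (K : Set (Euc d)) :
    IsFirstOrderOracle K (hardFun e s L) (hardOracle e s L) := by
  refine fun x _ => ⟨rfl, fun y _ => ?_⟩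
  have hy := mul_signedCoord_le_hardFun e s hL y (leastArgmax e s x)
  refine le_trans (le_of_eq ?_) hy
  simp only [hardOracle, hardFun, signedCoord, EuclideanSpace.inner_single_left, PiLp.sub_apply,
    conj_trivial]
  ring

theorem norm_hardOracle_snd {L : ℝ} (hL : 0 < L) (x : Euc d) :
    ‖(hardOracle e s L x).2‖ = L := by
  simp [hardOracle, abs_boolSign, abs_of_pos hL]

theorem measurable_leastArgmax : Measurable (leastArgmax e s) := by
  refine measurable_to_countable' fun i => ?_
  have : leastArgmax e s ⁻¹' {i} = {x | IsLeastArgmax e s x i} := by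
    ext x
    refine ⟨?_, fun h => (isLeastArgmax_leastArgmax e s x).unique h⟩
    rintro rfl
    exact isLeastArgmax_leastArgmax e s x
  rw [this]
  unfold IsLeastArgmax
  have hm := measurable_signedCoord e s
  simp only [Set.ofPred_forall]
  refine MeasurableSet.iInter fun j => ?_
  exact (measurableSet_lt (hm j) (hm i)).union
    ((measurableSet_eq_fun (hm j) (hm i)).inter (MeasurableSet.const _))

theorem measurable_hardOracle (L : ℝ) : Measurable (hardOracle e s L) := by
  have hg := measurable_leastArgmax e s
  have hf : Measurable (hardFun e s L) := by
    have h : Measurable fun p : Fin n × Euc d => signedCoord e s p.2 p.1 :=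
      measurable_from_prod_countable_right (measurable_signedCoord e s)
    exact (h.comp (hg.prodMk measurable_id)).const_mul L
  have hv : Measurable fun i : Fin n =>
      (EuclideanSpace.single (e i) (L * boolSign (s i)) : Euc d) := measurable_of_countable _
  exact hf.prodMk (hv.comp hg)

/-- The minimum of the hard function on the ball is at most `-L * B / √n`, the value at the point
with signed coordinates `-B / √n`; so a point of small value has all signed coordinates negative. -/
theorem IsSuboptimal.signedCoord_neg {e : Fin n ↪ Fin d} {s : Fin n → Bool} {L B ε : ℝ}
    (hL : 0 < L) (hB : 0 < B) (hn : (n : ℝ) * ε ^ 2 < (L * B) ^ 2) {x : Euc d}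
    (hx : IsSuboptimal (feasible d B) (hardFun e s L) ε x) (i : Fin n) :
    signedCoord e s x i < 0 := by
  have hn0 : (0 : ℝ) < n := Nat.cast_pos.2 (Nat.pos_of_ne_zero (NeZero.ne n))
  have hsq := Real.sqrt_pos.2 hn0
  have hc : 0 < B / √n := by positivity
  have hon : Orthonormal ℝ fun i : Fin n => (EuclideanSpace.single (e i) 1 : Euc d) := by
    simpa [Function.comp_def] using
      (EuclideanSpace.basisFun (Fin d) ℝ).orthonormal.comp e e.injective
  let y : Euc d := ∑ i : Fin n, (-(B / √n) * boolSign (s i)) • EuclideanSpace.single (e i) 1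
  have hyi : ∀ i, signedCoord e s y i = -(B / √n) := by
    intro i
    have h1 : y (e i) = -(B / √n) * boolSign (s i) := by
      simp [y, Pi.single_apply]
    rw [signedCoord, h1, mul_left_comm, boolSign_mul_self, mul_one]
  have hyK : y ∈ feasible d B := by
    rw [mem_closedBall_zero_iff]
    refine le_of_sq_le_sq ?_ hB.le
    rw [← real_inner_self_eq_norm_sq, hon.inner_sum]
    have : ∀ i : Fin n, (starRingEnd ℝ) (-(B / √n) * boolSign (s i)) *
        (-(B / √n) * boolSign (s i)) = B ^ 2 / n := by
      intro i
      rw [conj_trivial, mul_mul_mul_comm, boolSign_mul_self, mul_one, neg_mul_neg, ← sq, div_pow,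
        Real.sq_sqrt hn0.le]
    simp only [this, Finset.sum_const, Finset.card_univ, Fintype.card_fin, nsmul_eq_mul]
    field_simp
    exact le_rfl
  have h1 := hx.2 y hyK
  have h2 := mul_signedCoord_le_hardFun e s hL x i
  have h3 : hardFun e s L y = -(L * B / √n) := by
    rw [hardFun, hyi]; ring
  have h4 : ε < L * B / √n := by
    rw [lt_div_iff₀ hsq]
    refine lt_of_pow_lt_pow_left₀ 2 (by positivity) ?_
    rw [mul_pow, Real.sq_sqrt hn0.le]
    linarith
  refine neg_of_mul_neg_right (a := L) ?_ hL.le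
  linarith

end HardFunction

/-! ### Counting the sign vectors found by few queries -/

section Counting

variable {n d : ℕ} {e : Fin n ↪ Fin d}

/-- The sign vectors that agree with `σ` outside the set `U` of unknown signs. -/
def signCube (U : Finset (Fin n)) (σ : Fin n → Bool) : Finset (Fin n → Bool) :=
  {s | ∀ i ∉ U, s i = σ i}

theorem mem_signCube {U : Finset (Fin n)} {σ s : Fin n → Bool} :
    s ∈ signCube U σ ↔ ∀ i ∉ U, s i = σ i := by
  simp [signCube]

theorem signCube_update_subset {U : Finset (Fin n)} {i : Fin n} (hi : i ∈ U) (σ : Fin n → Bool)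
    (b : Bool) : signCube (U.erase i) (Function.update σ i b) ⊆ signCube U σ := by
  intro s hs
  rw [mem_signCube] at hs ⊢
  intro j hj
  have hji : j ≠ i := fun h => hj (h ▸ hi)
  simpa [hji] using hs j fun h => hj (Finset.mem_of_mem_erase h)

theorem apply_eq_of_mem_signCube_update {U : Finset (Fin n)} {i : Fin n} {σ s : Fin n → Bool}
    {b : Bool} (hs : s ∈ signCube (U.erase i) (Function.update σ i b)) : s i = b := by
  simpa using mem_signCube.1 hs i (Finset.notMem_erase i U)

theorem signCube_subset_union (U : Finset (Fin n)) (i : Fin n) (σ : Fin n → Bool) (b : Bool) :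
    signCube U σ ⊆ signCube (U.erase i) (Function.update σ i b) ∪
      signCube (U.erase i) (Function.update σ i !b) := by
  intro s hs
  have key : ∀ c, s i = c → s ∈ signCube (U.erase i) (Function.update σ i c) := by
    intro c hc
    rw [mem_signCube]
    intro j hj
    by_cases hji : j = i
    · subst hji; simpa using hc
    · simpa [hji] using mem_signCube.1 hs j fun h => hj (Finset.mem_erase.2 ⟨hji, h⟩)
  rw [Finset.mem_union]
  by_cases h : s i = b
  · exact Or.inl (key b h)
  · exact Or.inr (key _ (by cases hs : s i <;> cases b <;> simp_all))

/-- If the unknown signs are inspected in the order of decreasing `|x (e j)|`, ties broken by the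
index, then the oracle's response is determined as soon as an inspected coordinate has a
nonnegative signed value: none of the signs that are still unknown can influence it. -/
theorem hardOracle_congr [NeZero n] {U : Finset (Fin n)} {i : Fin n} {x : Euc d}
    (hmin : ∀ j ∈ U, toLex (-|x (e i)|, i) ≤ toLex (-|x (e j)|, j)) {s s' : Fin n → Bool}
    (hs : ∀ j ∉ U.erase i, s j = s' j) (hpos : 0 ≤ signedCoord e s x i) (L : ℝ) :
    hardOracle e s L x = hardOracle e s' L x := by
  have hi : s i = s' i := hs i (Finset.notMem_erase i U)
  have habs : ∀ r : Fin n → Bool, r i = s i → signedCoord e r x i = |x (e i)| := by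
    intro r hr
    rw [← abs_signedCoord e s, abs_of_nonneg hpos, signedCoord, signedCoord, hr]
  -- A still unknown coordinate never beats the `i`-th one.
  have hunk : ∀ r : Fin n → Bool, r i = s i → ∀ j ∈ U.erase i,
      signedCoord e r x j < signedCoord e r x i ∨
        (signedCoord e r x j = signedCoord e r x i ∧ i < j) := by
    intro r hr j hj
    obtain ⟨hji, hjU⟩ := Finset.mem_erase.1 hj
    have hle : signedCoord e r x j ≤ |x (e j)| := by
      rw [← abs_signedCoord e r]; exact le_abs_self _
    rw [habs r hr]
    rcases Prod.Lex.toLex_le_toLex.1 (hmin j hjU) with h | ⟨h, h'⟩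
    · exact Or.inl (by simp only at h; linarith)
    · rcases hle.lt_or_eq with h1 | h1
      · exact Or.inl (by simp only at h; linarith)
      · exact Or.inr ⟨by simp only at h; linarith, lt_of_le_of_ne h' hji.symm⟩
  have hg : leastArgmax e s x ∉ U.erase i := by
    intro hmem
    rcases hunk s rfl _ hmem with h | ⟨h, h'⟩ <;>
      rcases isLeastArgmax_leastArgmax e s x i with h1 | ⟨h1, h2⟩
    · linarith
    · linarith
    · linarith
    · exact absurd h' (not_lt.2 h2)
  have hcoord : ∀ j ∉ U.erase i, signedCoord e s' x j = signedCoord e s x j := by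
    intro j hj
    rw [signedCoord, signedCoord, hs j hj]
  have hspec : IsLeastArgmax e s' x (leastArgmax e s x) := by
    have hbest := isLeastArgmax_leastArgmax e s x
    intro j
    rw [hcoord _ hg]
    by_cases hj : j ∈ U.erase i
    · have h1 := hbest i
      have h2 := hunk s' hi.symm j hj
      rw [hcoord i (Finset.notMem_erase i U)] at h2
      rcases h2 with h2 | ⟨h2, h2'⟩ <;> rcases h1 with h1 | ⟨h1, h1'⟩
      · exact Or.inl (h2.trans h1)
      · exact Or.inl (h2.trans_eq h1)
      · exact Or.inl (h2.trans_lt h1)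
      · exact Or.inr ⟨h2.trans h1, h1'.trans h2'.le⟩
    · rw [hcoord j hj]
      exact hbest j
  have heq : leastArgmax e s' x = leastArgmax e s x :=
    (isLeastArgmax_leastArgmax e s' x).unique hspec
  simp only [hardOracle, hardFun, heq, hcoord _ hg, hs _ hg]

variable {B : ℝ} {Ω : Type*} [MeasurableSpace Ω] [NeZero n]

open Classical in
/-- The sign vectors in a cube for which one of the `r` queries after the first `t` ones makes all
signed coordinates negative. -/
noncomputable def hitSet (A : RandomizedAlgorithm d B Ω) (e : Fin n ↪ Fin d) (L : ℝ) (ω : Ω)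
    (r t : ℕ) (U : Finset (Fin n)) (σ : Fin n → Bool) : Finset (Fin n → Bool) :=
  {s ∈ signCube U σ | ∃ j < r, ∀ i,
    signedCoord e s (A.iterate (hardOracle e s L) ω (t + j)) i < 0}

theorem mem_hitSet {A : RandomizedAlgorithm d B Ω} {L : ℝ} {ω : Ω} {r t : ℕ}
    {U : Finset (Fin n)} {σ s : Fin n → Bool} :
    s ∈ hitSet A e L ω r t U σ ↔ s ∈ signCube U σ ∧ ∃ j < r, ∀ i,
      signedCoord e s (A.iterate (hardOracle e s L) ω (t + j)) i < 0 := by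
  simp [hitSet]

/-- If the first `t` responses do not distinguish the sign vectors of a cube with `m` unknown
signs, then the next `r` queries hit at most a fraction `3 ^ r * (3 / 4) ^ m` of them. -/
theorem card_hitSet_le (A : RandomizedAlgorithm d B Ω) (L : ℝ) (ω : Ω) (r : ℕ) :
    ∀ (t : ℕ) (U : Finset (Fin n)) (σ : Fin n → Bool) (h : Fin t → Response d),
      (∀ s ∈ signCube U σ, A.history (hardOracle e s L) ω t = h) →
      ((hitSet A e L ω r t U σ).card : ℝ) ≤ 3 ^ r * (3 / 2) ^ U.card := by
  induction r with
  | zero =>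
    intro t U σ h _
    have : hitSet A e L ω 0 t U σ = ∅ := by
      ext s; simp [mem_hitSet]
    rw [this]
    simp only [Finset.card_empty, Nat.cast_zero]
    positivity
  | succ r ih =>
    -- The next query is the same for the whole cube. Its response reveals the unknown signs in the
    -- order of `hardOracle_congr`, up to the first nonnegative signed coordinate.
    have inner : ∀ (m t : ℕ) (U : Finset (Fin n)) (σ : Fin n → Bool) (h : Fin t → Response d),
        U.card = m → (∀ s ∈ signCube U σ, A.history (hardOracle e s L) ω t = h) →
        ((hitSet A e L ω (r + 1) t U σ).card : ℝ) ≤ 3 ^ r * (2 * (3 / 2) ^ m) + 1 := by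
      intro m
      induction m with
      | zero =>
        intro t U σ h hU _
        have hsub : hitSet A e L ω (r + 1) t U σ ⊆ {σ} := by
          intro s hs
          have := mem_signCube.1 (mem_hitSet.1 hs).1
          rw [Finset.card_eq_zero.1 hU] at this
          exact Finset.mem_singleton.2 (funext fun i => this i (Finset.notMem_empty i))
        have h1 : ((hitSet A e L ω (r + 1) t U σ).card : ℝ) ≤ 1 := by
          exact_mod_cast Finset.card_le_card hsub
        have : (0 : ℝ) ≤ 3 ^ r * (2 * (3 / 2) ^ 0) := by positivity
        linarith
      | succ m ihm =>
        intro t U σ h hU hh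
        set x := A.query t ω h with hx
        have hne : U.Nonempty := Finset.card_pos.1 (by omega)
        obtain ⟨i, hiU, hmin⟩ :=
          Finset.exists_min_image U (fun j => toLex (-|x (e j)|, j)) hne
        have hcard : (U.erase i).card = m := by
          rw [Finset.card_erase_of_mem hiU, hU]; rfl
        -- The sign `b` makes the `i`-th signed coordinate nonnegative.
        obtain ⟨b, hb⟩ : ∃ b : Bool, 0 ≤ boolSign b * x (e i) := by
          rcases le_total 0 (x (e i)) with h0 | h0
          · exact ⟨true, by simpa [boolSign] using h0⟩
          · exact ⟨false, by simpa [boolSign] using h0⟩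
        have hsubc := signCube_update_subset hiU σ
        have hsplit : hitSet A e L ω (r + 1) t U σ ⊆
            hitSet A e L ω r (t + 1) (U.erase i) (Function.update σ i b) ∪
              hitSet A e L ω (r + 1) t (U.erase i) (Function.update σ i !b) := by
          intro s hs
          obtain ⟨hsc, j, hj, hneg⟩ := mem_hitSet.1 hs
          rcases Finset.mem_union.1 (signCube_subset_union U i σ b hsc) with hs1 | hs1
          · refine Finset.mem_union_left _ (mem_hitSet.2 ⟨hs1, ?_⟩)
            rcases j with _ | j
            · have h1 := hneg i
              rw [add_zero, RandomizedAlgorithm.iterate, hh s hsc, ← hx, signedCoord,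
                apply_eq_of_mem_signCube_update hs1] at h1
              exact absurd h1 (not_lt.2 hb)
            · refine ⟨j, by omega, ?_⟩
              rwa [add_assoc, add_comm 1 j]
          · exact Finset.mem_union_right _ (mem_hitSet.2 ⟨hs1, j, hj, hneg⟩)
        have hbound1 := ih (t + 1) (U.erase i) (Function.update σ i b)
          (Fin.snoc (α := fun _ => Response d) h (hardOracle e (Function.update σ i b) L x)) (by
            intro s hs
            rw [RandomizedAlgorithm.history, hh s (hsubc b hs), ← hx]
            congr 1
            refine hardOracle_congr hmin (mem_signCube.1 hs) ?_ L
            rwa [signedCoord, apply_eq_of_mem_signCube_update hs])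
        have hbound2 := ihm t (U.erase i) (Function.update σ i !b) h hcard
          fun s hs => hh s (hsubc _ hs)
        have hle : ((hitSet A e L ω (r + 1) t U σ).card : ℝ) ≤
            (hitSet A e L ω r (t + 1) (U.erase i) (Function.update σ i b)).card +
              (hitSet A e L ω (r + 1) t (U.erase i) (Function.update σ i !b)).card := by
          exact_mod_cast (Finset.card_le_card hsplit).trans (Finset.card_union_le _ _)
        rw [hcard] at hbound1
        calc ((hitSet A e L ω (r + 1) t U σ).card : ℝ)
            ≤ 3 ^ r * (3 / 2) ^ m + (3 ^ r * (2 * (3 / 2) ^ m) + 1) :=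
              hle.trans (add_le_add hbound1 hbound2)
          _ = 3 ^ r * (2 * (3 / 2) ^ (m + 1)) + 1 := by ring
    intro t U σ h hh
    refine (inner _ t U σ h rfl hh).trans ?_
    have h1 : (1 : ℝ) ≤ 3 ^ r * (3 / 2) ^ U.card :=
      one_le_mul_of_one_le_of_one_le (one_le_pow₀ (by norm_num)) (one_le_pow₀ (by norm_num))
    rw [pow_succ]
    linarith

end Counting

/-! ### Averaging over signs and outcomes -/

section Averaging

variable {n d : ℕ} {B : ℝ} {Ω : Type*} [MeasurableSpace Ω]

theorem RandomizedAlgorithm.measurable_iterate (A : RandomizedAlgorithm d B Ω)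
    {O : Euc d → Response d} (hO : Measurable O) (t : ℕ) :
    Measurable fun ω => A.iterate O ω t := by
  have key : ∀ t, Measurable fun ω => A.history O ω t := by
    intro t
    induction t with
    | zero => exact measurable_pi_lambda _ fun i => i.elim0
    | succ t ih =>
      refine measurable_pi_lambda _ fun i => ?_
      simp only [RandomizedAlgorithm.history]
      induction i using Fin.lastCases with
      | last =>
        simp only [Fin.snoc_last]
        exact hO.comp ((A.measurable_query t).comp (measurable_id.prodMk ih))
      | cast i =>
        simp only [Fin.snoc_castSucc]
        exact (measurable_pi_apply i).comp ih
  exact (A.measurable_query t).comp (measurable_id.prodMk (key t))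

/-- The outcomes for which none of the first `r` queries makes all signed coordinates negative. -/
def missEvent (A : RandomizedAlgorithm d B Ω) (e : Fin n ↪ Fin d) [NeZero n] (L : ℝ) (r : ℕ)
    (s : Fin n → Bool) : Set Ω :=
  {ω | ∀ j < r, ∃ i, 0 ≤ signedCoord e s (A.iterate (hardOracle e s L) ω j) i}

variable [NeZero n]

theorem measurableSet_missEvent (A : RandomizedAlgorithm d B Ω) (e : Fin n ↪ Fin d) (L : ℝ)
    (r : ℕ) (s : Fin n → Bool) : MeasurableSet (missEvent A e L r s) := by
  have : missEvent A e L r s =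
      ⋂ j, ⋂ (_ : j < r), ⋃ i, {ω | 0 ≤ signedCoord e s (A.iterate (hardOracle e s L) ω j) i} := by
    ext ω; simp [missEvent]
  rw [this]
  refine MeasurableSet.iInter fun j => MeasurableSet.iInter fun _ => MeasurableSet.iUnion fun i => ?_
  exact measurableSet_le measurable_const ((measurable_signedCoord e s i).comp
    (A.measurable_iterate (measurable_hardOracle e s L) j))

/-- With `n = 4 * (r + 1)` signs, at least half of the sign vectors are missed by the first `r`
queries. -/
theorem two_pow_le_sum_indicator_missEvent (A : RandomizedAlgorithm d B Ω) (e : Fin n ↪ Fin d)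
    (L : ℝ) {r : ℕ} (hn : n = 4 * (r + 1)) (ω : Ω) :
    (2 ^ n : ℝ≥0∞) / 2 ≤ ∑ s : Fin n → Bool, (missEvent A e L r s).indicator 1 ω := by
  classical
  have huniv : signCube (Finset.univ : Finset (Fin n)) (fun _ => true) = Finset.univ := by
    ext s; simp [mem_signCube]
  set H := hitSet A e L ω r 0 Finset.univ (fun _ => true) with hH
  have hcard : (H.card : ℝ) ≤ 3 ^ r * (3 / 2) ^ n := by
    simpa using card_hitSet_le (e := e) A L ω r 0 Finset.univ (fun _ => true)
      (fun i => i.elim0) fun s _ => rfl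
  -- `3 ^ (r + 1) * (3 / 4) ^ n ≤ 1` because `3 * (3 / 4) ^ 4 = 243 / 256`.
  have hhalf : (H.card : ℝ) ≤ 2 ^ n / 2 := by
    have h1 : (3 : ℝ) ^ (r + 1) * (3 / 2) ^ n ≤ 2 ^ n := by
      rw [hn, pow_mul, pow_mul, ← mul_pow]
      exact pow_le_pow_left₀ (by norm_num) (by norm_num) _
    have h2 : (0 : ℝ) ≤ 3 ^ r * (3 / 2) ^ n := by positivity
    rw [pow_succ] at h1
    linarith
  have hsum : (∑ s : Fin n → Bool, (missEvent A e L r s).indicator 1 ω : ℝ≥0∞) =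
      (Hᶜ.card : ℝ≥0∞) := by
    have : ∀ s : Fin n → Bool, (missEvent A e L r s).indicator (1 : Ω → ℝ≥0∞) ω =
        if s ∈ Hᶜ then 1 else 0 := by
      intro s
      rw [Set.indicator_apply]
      refine if_congr ?_ rfl rfl
      simp [hH, mem_hitSet, huniv, missEvent]
    simp only [this, Finset.sum_ite_mem, Finset.univ_inter, Finset.sum_const, nsmul_eq_mul,
      mul_one]
  have hc : 2 ^ n ≤ Hᶜ.card * 2 := by
    have h3 : H.card + Hᶜ.card = 2 ^ n := by
      rw [Finset.card_add_card_compl]; simp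
    have h4 : H.card * 2 ≤ 2 ^ n := by
      have : (H.card : ℝ) * 2 ≤ 2 ^ n := by linarith
      exact_mod_cast this
    omega
  rw [hsum]
  refine ENNReal.div_le_of_le_mul ?_
  exact_mod_cast hc

/-- Some sign vector is missed by the first `r` queries with probability at least one half. -/
theorem exists_half_le_measure_missEvent (P : MeasureTheory.Measure Ω)
    [MeasureTheory.IsProbabilityMeasure P] (A : RandomizedAlgorithm d B Ω) (e : Fin n ↪ Fin d)
    (L : ℝ) {r : ℕ} (hn : n = 4 * (r + 1)) :
    ∃ s : Fin n → Bool, 1 / 2 ≤ P (missEvent A e L r s) := by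
  by_contra! hlt
  have hmeas := measurableSet_missEvent A e L r
  have h1 : (2 ^ n : ℝ≥0∞) / 2 ≤ ∑ s : Fin n → Bool, P (missEvent A e L r s) := by
    calc (2 ^ n : ℝ≥0∞) / 2 = ∫⁻ _, (2 ^ n : ℝ≥0∞) / 2 ∂P := by simp
      _ ≤ ∫⁻ ω, ∑ s : Fin n → Bool, (missEvent A e L r s).indicator 1 ω ∂P :=
          MeasureTheory.lintegral_mono (two_pow_le_sum_indicator_missEvent A e L hn)
      _ = ∑ s : Fin n → Bool, P (missEvent A e L r s) := by
          rw [MeasureTheory.lintegral_finsetSum _ fun s _ => measurable_one.indicator (hmeas s)]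
          simp only [MeasureTheory.lintegral_indicator_one (hmeas _)]
  have h2 : ∑ s : Fin n → Bool, P (missEvent A e L r s) < ∑ _s : Fin n → Bool, (1 / 2 : ℝ≥0∞) :=
    ENNReal.sum_lt_sum_of_nonempty Finset.univ_nonempty fun s _ => hlt s
  refine absurd (h1.trans_lt h2) (not_lt.2 (le_of_eq ?_))
  simp [div_eq_mul_inv]

theorem RandomizedAlgorithm.le_queryCount (A : RandomizedAlgorithm d B Ω)
    {O : Euc d → Response d} {f : Euc d → ℝ} {ε : ℝ} {ω : Ω} {r : ℕ}
    (h : ∀ j < r, ¬ IsSuboptimal (feasible d B) f ε (A.iterate O ω j)) :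
    ((r + 1 : ℕ) : ℝ≥0∞) ≤ A.queryCount O f ε ω := by
  refine le_iInf₂ fun t ht => ?_
  have : r ≤ t := not_lt.1 fun hlt => h t hlt ht
  exact_mod_cast Nat.succ_le_succ this

end Averaging

theorem theorem1 :
    ∃ C : ℝ, 0 < C ∧
      ∀ (L B ε : ℝ) (d : ℕ), 0 < L → 0 < B → 0 < ε → ε < L * B / 2 →
        2 * L ^ 8 * B ^ 8 / ε ^ 8 * Real.log (L ^ 4 * B ^ 4 / ε ^ 4) ≤ (d : ℝ) →
        ∀ (Ω : Type*) [MeasurableSpace Ω] (P : MeasureTheory.Measure Ω)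
          [MeasureTheory.IsProbabilityMeasure P] (A : RandomizedAlgorithm d B Ω),
          ∃ (f : Euc d → ℝ) (O : Euc d → Response d),
            ConvexOn ℝ (feasible d B) f ∧
            LipschitzOnWith L.toNNReal f (feasible d B) ∧
            IsFirstOrderOracle (feasible d B) f O ∧
            (∀ x ∈ feasible d B, ‖(O x).2‖ ≤ L) ∧
            Measurable O ∧
            ENNReal.ofReal (C * (L ^ 2 * B ^ 2 / ε ^ 2)) ≤ ∫⁻ ω, A.queryCount O f ε ω ∂P := by
  refine ⟨1 / 16, by norm_num, ?_⟩
  intro L B ε d hL hB hε hLB hd Ω _ P _ A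
  have hLB0 : 0 < L * B := mul_pos hL hB
  set u : ℝ := L * B / ε with hu
  have hu2 : 2 < u := by
    rw [hu, lt_div_iff₀ hε]; linarith
  have hsq : L ^ 2 * B ^ 2 / ε ^ 2 = u ^ 2 := by
    rw [hu, div_pow, mul_pow]
  -- Take `n = 4 * (r + 1)` with `r + 1` the largest integer smaller than `u ^ 2 / 4`.
  obtain ⟨r, hr1, hr2⟩ : ∃ r : ℕ, (4 * (r + 1) : ℝ) < u ^ 2 ∧ u ^ 2 ≤ 8 * (r + 1) := by
    have hc1 := Nat.ceil_lt_add_one (show 0 ≤ u ^ 2 / 4 by positivity)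
    have hc2 := Nat.le_ceil (u ^ 2 / 4)
    have hc3 : 1 < ⌈u ^ 2 / 4⌉₊ := by
      rw [Nat.lt_ceil, Nat.cast_one]; nlinarith
    obtain ⟨r, hr⟩ := Nat.exists_eq_add_of_lt hc3
    rw [hr] at hc1 hc2
    push_cast at hc1 hc2
    refine ⟨r, by linarith, ?_⟩
    have : (0 : ℝ) ≤ r := Nat.cast_nonneg r
    linarith
  have hnd : 4 * (r + 1) ≤ d := by
    have h1 : 2 * L ^ 8 * B ^ 8 / ε ^ 8 * Real.log (L ^ 4 * B ^ 4 / ε ^ 4)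
        = 2 * u ^ 8 * Real.log (u ^ 4) := by
      rw [hu, div_pow, div_pow, mul_pow, mul_pow]; ring
    rw [h1] at hd
    have hlog : 1 ≤ Real.log (u ^ 4) := by
      rw [Real.le_log_iff_exp_le (by positivity)]
      have h2 : (2 : ℝ) ^ 4 ≤ u ^ 4 := pow_le_pow_left₀ (by norm_num) hu2.le 4
      linarith [Real.exp_one_lt_d9]
    have h3 : u ^ 2 ≤ u ^ 8 := pow_le_pow_right₀ (by linarith) (by norm_num)
    have h4 : 2 * u ^ 8 * 1 ≤ 2 * u ^ 8 * Real.log (u ^ 4) :=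
      mul_le_mul_of_nonneg_left hlog (by positivity)
    have h5 : 0 ≤ u ^ 8 := by positivity
    have h6 : (4 * (r + 1) : ℝ) ≤ d := by linarith
    exact_mod_cast h6
  have hn : ((4 * (r + 1) : ℕ) : ℝ) * ε ^ 2 < (L * B) ^ 2 := by
    rw [← lt_div_iff₀ (by positivity), ← div_pow, ← hu]
    push_cast
    exact hr1
  let e : Fin (4 * (r + 1)) ↪ Fin d := Fin.castLEEmb hnd
  have : NeZero (4 * (r + 1)) := ⟨by omega⟩
  obtain ⟨s, hs⟩ := exists_half_le_measure_missEvent P A e L rfl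
  refine ⟨hardFun e s L, hardOracle e s L, convexOn_hardFun e s hL (convex_closedBall 0 B),
    lipschitzOnWith_hardFun e s hL _, isFirstOrderOracle_hardOracle e s hL _,
    fun x _ => (norm_hardOracle_snd e s hL x).le, measurable_hardOracle e s L, ?_⟩
  calc ENNReal.ofReal (1 / 16 * (L ^ 2 * B ^ 2 / ε ^ 2))
      ≤ ENNReal.ofReal ((r + 1 : ℕ) * (1 / 2)) := by
        refine ENNReal.ofReal_le_ofReal ?_
        rw [hsq]
        push_cast
        linarith
    _ = ((r + 1 : ℕ) : ℝ≥0∞) * (1 / 2) := by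
        rw [ENNReal.ofReal_mul (Nat.cast_nonneg _), ENNReal.ofReal_natCast,
          ENNReal.ofReal_div_of_pos two_pos, ENNReal.ofReal_one, ENNReal.ofReal_ofNat]
    _ ≤ ((r + 1 : ℕ) : ℝ≥0∞) * P (missEvent A e L r s) := by gcongr
    _ = ∫⁻ ω, (missEvent A e L r s).indicator (fun _ => ((r + 1 : ℕ) : ℝ≥0∞)) ω ∂P :=
        (MeasureTheory.lintegral_indicator_const (measurableSet_missEvent A e L r s) _).symm
    _ ≤ ∫⁻ ω, A.queryCount (hardOracle e s L) (hardFun e s L) ε ω ∂P := by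
        refine MeasureTheory.lintegral_mono fun ω => ?_
        refine Set.indicator_le' (fun ω hω => ?_) (fun _ _ => bot_le) ω
        refine A.le_queryCount fun j hj hsub => ?_
        obtain ⟨i, hi⟩ := hω j hj
        exact absurd (hsub.signedCoord_neg hL hB hn i) (not_lt.2 hi)
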